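/- Let $\mathbb K$ be a field and let $q,t$ be indeterminates. Let $\mathbf{FQSym}$ be the algebra of free quasi-symmetric functions over $\mathbb K(t)$, with basis $\mathbf G_\sigma$ ($\sigma\in\mathfrak S_n$, $n\ge 0$), product $\mathbf G_\alpha\mathbf G_\beta=\sum\mathbf G_\gamma$ over all permutations $\gamma=u\cdot v$ with $\mathrm{std}(u)=\alpha$, $\mathrm{std}(v)=\beta$, internal product $\mathbf G_\sigma*\mathbf G_\tau=\mathbf G_{\tau\circ\sigma}$ (zero if the sizes differ), scalar product $(\mathbf G_\sigma,\mathbf G_\tau)=\delta_{\sigma,\tau^{-1}}$ and dual basis $\mathbf F_\sigma=\mathbf G_{\sigma^{-1}}$. Put $S_n=\mathbf G_{12\cdots n}$, $\Lambda_n=\mathbf G_{n\cdots 21}$ and $\mathbf G_\sigma((1-t)A)=\mathbf G_\sigma*\sum_{k+l=n}(-t)^k\Lambda_kS_l$ for $\sigma\in\mathfrak S_n$, and let $f\mapsto f(A\cdot(1-t))$ be the adjoint of the linear map $\mathbf G_\sigma\mapsto\mathbf G_\sigma((1-t)A)$. The specialization $f(\mathbb X)\in\mathbb K(t)[[q]]\subset\mathbb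 K(t)((q))$ of $f\in\mathbf{FQSym}$ at $\mathbb X=\frac1{1-q}\,\hat\times\,(1-t)$ is obtained by applying to $f(A\cdot(1-t))$ the linear map $\mathbf F_\sigma\mapsto F_{D(\sigma)}\bigl(\tfrac1{1-q}\bigr)=\sum q^{a_1+\cdots+a_n}$, the sum being over all integers $a_1\ge a_2\ge\cdots\ge a_n\ge0$ with $a_i>a_{i+1}$ whenever $\sigma_i>\sigma_{i+1}$ (Gessel's fundamental quasi-symmetric function evaluated at the ordered alphabet $\cdots<q^2<q<1$). For a binary tree $T$ with $\#T$ nodes let $\mathbf P_T=\sum_{P(\sigma)=T}\mathbf F_\sigma$, where $P(\sigma)$ is the shape of the binary search tree obtained by inserting the letters of $\sigma$ from right to left. (1) Let $T$ be a nonempty binary tree with $n$ nodes, let $T_1$ and $T_2$ be its left and right subtrees, and let $T_2'$ be the left subtree of $T_2$ (empty if $T_2$ is empty). Then $$\mathbf P_T(\mathbb X)=\frac{(q^{\#T_2}-q^{\#T_2'}t)(1-q^{\#T_1}t)}{(1-q^{\#T_2'}t)(1-q^n)}\,\mathbf P_{T_1}(\mathbb X)\,\mathbf P_{T_2}(\mathbb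 X).$$ (2) For every binary tree $T$, $\mathbf P_T(\mathbb X)$ is the product over all nodes $s$ of $T$ of the factors $$\frac1{1-q^{n_s}}\cdot\begin{cases}q^{n'}-q^{n''}t&\text{if } s \text{ has a right son},\\ 1-q^{n_s-1}t&\text{if } s \text{ has no right son and is not the right son of its father},\\ 1-q^{d}t&\text{if } s\text{ has no right son and is the right son of its father},\end{cases}$$ where $n_s$ is the size of the subtree rooted at $s$, $n'$ is the size of the right subtree of $s$, $n''$ is the size of the left subtree of the right subtree of $s$, and $d$ is the size of the left subtree of the topmost ancestor of $s$ from which $s$ is reached only by right branches. -/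

import Mathlib

open Equiv

noncomputable section

namespace SuperHook

/-! ### Free quasi-symmetric functions -/

/-- The underlying module of `FQSym` over `K`: finitely supported families of coordinates on the
basis `G_σ`, where `σ` runs over the permutations of `Fin n` for all `n`.
A permutation is identified with the word `σ 0, σ 1, …, σ (n - 1)`. -/
abbrev FQSym (K : Type*) [CommRing K] : Type _ := (Σ n : ℕ, Perm (Fin n)) →₀ K

section FQSym

variable (K : Type*) [CommRing K]

/-- The basis element `G_σ`. -/
def G {n : ℕ} (σ : Perm (Fin n)) : FQSym K := Finsupp.single ⟨n, σ⟩ 1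

/-- The dual basis element `F_σ = G_{σ⁻¹}`. -/
def F {n : ℕ} (σ : Perm (Fin n)) : FQSym K := G K σ⁻¹

/-- `γ = u · v` with `std u = α` and `std v = β` (words without repeated letters have the same
standardization iff their letters are in the same relative order). -/
def IsConvolution {k l : ℕ} (α : Perm (Fin k)) (β : Perm (Fin l)) (γ : Perm (Fin (k + l))) :
    Prop :=
  (∀ i j, γ (Fin.castAdd l i) < γ (Fin.castAdd l j) ↔ α i < α j) ∧
    ∀ i j, γ (Fin.natAdd k i) < γ (Fin.natAdd k j) ↔ β i < β j

variable {K}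

open Classical in
/-- The product of `FQSym`: `G_α G_β` is the sum of the `G_γ` with `γ = u · v`, `std u = α`,
`std v = β`. -/
def mul (f g : FQSym K) : FQSym K :=
  f.sum fun a x => g.sum fun b y =>
    (x * y) • ∑ γ : Perm (Fin (a.1 + b.1)) with IsConvolution a.2 b.2 γ, G K γ

/-- The internal product of `FQSym`: `G_σ * G_τ = G_{τ ∘ σ}` if `σ` and `τ` have the same size,
and `0` otherwise. -/
def internalMul (f g : FQSym K) : FQSym K :=
  f.sum fun a x => g.sum fun b y =>
    if h : a.1 = b.1 then (x * y) • G K (b.2 * (finCongr h).permCongr a.2) else 0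

/-- The scalar product of `FQSym`, for which `(G_σ, G_τ) = δ_{σ, τ⁻¹}`. -/
def pairing (f g : FQSym K) : K := f.sum fun a x => x * g ⟨a.1, a.2⁻¹⟩

variable (K)

/-- The noncommutative complete function `S_n = G_{12⋯n}`. -/
def S (n : ℕ) : FQSym K := G K (1 : Perm (Fin n))

/-- The noncommutative elementary function `Λ_n = G_{n⋯21}`. -/
def Lam (n : ℕ) : FQSym K := G K (Fin.revPerm : Perm (Fin n))

variable {K}

/-- `S_n((1 - t)A)`, the component of degree `n` of `σ_1((1 - t)A) = λ_{-t}(A) σ_1(A)`. -/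
def SOneSub (t : K) (n : ℕ) : FQSym K :=
  ∑ p ∈ Finset.HasAntidiagonal.antidiagonal n, (-t) ^ p.1 • mul (Lam K p.1) (S K p.2)

/-- `G_σ((1 - t)A) = G_σ(A) * σ_1((1 - t)A)`. -/
def GOneSub (t : K) {n : ℕ} (σ : Perm (Fin n)) : FQSym K :=
  internalMul (G K σ) (SOneSub t n)

/-- `f(A·(1 - t))`: the adjoint, for the scalar product of `FQSym`, of the linear map
`G_β ↦ G_β((1 - t)A)`, applied to `f`. It is given on the basis by
`F_σ(A·(1 - t)) = ∑_β (F_σ, G_β((1 - t)A)) F_β`. Here `F_σ` is `G_{σ⁻¹}`, so the coordinate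
`x` of `f` on `G_a` is its coordinate on `F_{a⁻¹}`. -/
def dualOneSub (t : K) (f : FQSym K) : FQSym K :=
  f.sum fun a x =>
    x • ∑ β : Perm (Fin a.1), pairing (F K a.2⁻¹) (GOneSub t β) • F K β

end FQSym

/-! ### Quasi-symmetric functions and the alphabet `1/(1 - q)` -/

section QSym

variable (K : Type*) [CommRing K]

/-- Gessel's fundamental quasi-symmetric function `F_{D(σ)}` over the totally ordered alphabet
`(x_i)_{i ∈ ι}`: the sum of the monomials `x_{s_1} ⋯ x_{s_n}` with `s_1 ≤ ⋯ ≤ s_n` and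
`s_i < s_{i+1}` whenever `σ_i > σ_{i+1}`. -/
def gesselF (ι : Type*) [LinearOrder ι] {n : ℕ} (σ : Perm (Fin n)) : MvPowerSeries ι K :=
  fun m => (Set.ncard {s : Fin n → ι | Monotone s ∧
    (∀ i j : Fin n, (j : ℕ) = i + 1 → σ j < σ i → s i < s j) ∧
    ∑ i, Finsupp.single (s i) 1 = m} : K)

variable {K}

/-- Evaluation of a series of bounded degree at the alphabet `1/(1 - q) = {⋯ < q² < q < 1}`,
that is `x_i ↦ q^i`. The order of this alphabet is the one for which
`σ_1(A/(1 - q)) = ⋯ σ_{q²}(A) σ_q(A) σ_1(A)`, so the index set is `ℕ` with its order reversed.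
The variable `q` is the power series variable. -/
def evalGeom (f : MvPowerSeries ℕᵒᵈ K) : PowerSeries K :=
  PowerSeries.mk fun N =>
    ∑ᶠ (m : ℕᵒᵈ →₀ ℕ) (_ : (m.sum fun i a => OrderDual.ofDual i * a) = N), MvPowerSeries.coeff m f

/-- The specialization `A = 1/(1 - q)` of an element of `FQSym`: the linear map
`F_σ ↦ F_{D(σ)}(1/(1 - q))`. -/
def specGeom (f : FQSym K) : PowerSeries K :=
  f.sum fun a x => x • evalGeom (gesselF K ℕᵒᵈ a.2⁻¹)

/-- The specialization `f(𝕏)` at `𝕏 = 1/(1 - q) ×̂ (1 - t)`. -/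
def specX (t : K) (f : FQSym K) : PowerSeries K := specGeom (dualOneSub t f)

end QSym

/-! ### Binary trees -/

/-- Insertion of a letter in a binary search tree. -/
def bstInsert (x : ℕ) : BinaryTree ℕ → BinaryTree ℕ
  | .nil => .node x .nil .nil
  | .node y l r => if x ≤ y then .node y (bstInsert x l) r else .node y l (bstInsert x r)

/-- `P(σ)`: the shape of the binary search tree of `σ`, obtained by inserting the letters of the
word `σ` from right to left (so that the last letter is at the root, and `P(σ)` is the shape of
the decreasing tree of `σ⁻¹`). -/
def bstShape {n : ℕ} (σ : Perm (Fin n)) : BinaryTree Unit :=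
  ((List.ofFn fun i => (σ i : ℕ)).foldr bstInsert .nil).map fun _ => ()

/-- The element `P_T = ∑_{P(σ) = T} F_σ` of the Loday–Ronco algebra, in `FQSym`. -/
def P (K : Type*) [CommRing K] (T : BinaryTree Unit) : FQSym K :=
  ∑ σ : Perm (Fin T.numNodes) with bstShape σ = T, F K σ

/-! ### The field of coefficients: Laurent series in `q` over the field `𝕜(t)` -/

section Coefficients

variable (𝕜 : Type*) [Field 𝕜]

/-- The indeterminate `q`. -/
def q : LaurentSeries (RatFunc 𝕜) := HahnSeries.ofPowerSeries ℤ (RatFunc 𝕜) PowerSeries.X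

/-- The indeterminate `t`. -/
def t : LaurentSeries (RatFunc 𝕜) := HahnSeries.C RatFunc.X

/-- `P_T(𝕏)`. -/
def PX (T : BinaryTree Unit) : LaurentSeries (RatFunc 𝕜) :=
  HahnSeries.ofPowerSeries ℤ (RatFunc 𝕜) (specX (RatFunc.X : RatFunc 𝕜) (P (RatFunc 𝕜) T))

end Coefficients

/-! ### Nodes and hook-contents -/

/-- The nodes of a tree, encoded by the path from the root: `false` is a step to the left son,
`true` a step to the right son. -/
def nodes : BinaryTree Unit → Finset (List Bool)
  | .nil => ∅
  | .node _ l r => {[]} ∪ (nodes l).image (List.cons false) ∪ (nodes r).image (List.cons true)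

/-- The subtree rooted at the end of a path. -/
def subtreeAt : BinaryTree Unit → List Bool → BinaryTree Unit
  | T, [] => T
  | T, b :: s => subtreeAt (if b then T.right else T.left) s

/-- The topmost ancestor of `s` (possibly `s` itself) from which `s` is reached only by right
branches: all the final right steps of the path are removed. -/
def topAncestor (s : List Bool) : List Bool := s.rdropWhile fun b => b

/-- The `(q,t)`-hook-content factor of the node `s` of `T`. -/
def hookContent (𝕜 : Type*) [Field 𝕜] (T : BinaryTree Unit) (s : List Bool) :
    LaurentSeries (RatFunc 𝕜) :=
  let U := subtreeAt T s
  1 / (1 - q 𝕜 ^ U.numNodes) *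
    (if U.right ≠ .nil then
      q 𝕜 ^ U.right.numNodes - q 𝕜 ^ U.right.left.numNodes * t 𝕜
    else if s.getLast? = some true then
      1 - q 𝕜 ^ (subtreeAt T (topAncestor s)).left.numNodes * t 𝕜
    else
      1 - q 𝕜 ^ (U.numNodes - 1) * t 𝕜)

end SuperHook

end

/-!
Expanding `λ_{-t} σ_1` turns `F_σ(𝕏)` into a generating series of labellings of the letters of `σ`
by pairs (exponent of `q`, bar), a bar contributing `-t`: the labelled letters have to be sorted,
by decreasing exponent, then barred before unbarred, the barred ones decreasingly and the unbarred
ones increasingly. A labelling of the letters determines `σ`, namely as the permutation sorting it,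
and `P(σ) = T` holds exactly when the keys, placed on the nodes of `T` in infix order, form a
decreasing tree. So `P_T(𝕏)` is the series of decreasing labellings of the nodes of `T`.

Removing the root, with exponent `j`, leaves decreasing labellings of the two subtrees whose
exponents are bounded below: by `j` on the left, or `j + 1` if the root is barred, and on the right
by `j` for barred labels and `j + 1` for unbarred ones. Shifting all exponents of a subtree factors
out a power of `q`, and the sum over the label of the root is geometric. The bounds enter only
through one numerator, linearly; moving that factor down the right branches produces the
hook-contents.
-/

noncomputable section

namespace SuperHook

section Coordinates

variable {K : Type*} [CommRing K]

lemma G_apply {n : ℕ} (σ τ : Perm (Fin n)) : G K σ ⟨n, τ⟩ = if σ = τ then 1 else 0 := by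
  simp [G, Finsupp.single_apply]

open Classical in
lemma mul_G_G_apply {k l : ℕ} (α : Perm (Fin k)) (β : Perm (Fin l)) (γ : Perm (Fin (k + l))) :
    mul (G K α) (G K β) ⟨k + l, γ⟩ = if IsConvolution α β γ then 1 else 0 := by
  have mul_G_G : mul (G K α) (G K β) =
      ∑ γ : Perm (Fin (k + l)) with IsConvolution α β γ, G K γ := by
    simp [mul, G]
  simp [mul_G_G, Finsupp.finsetSum_apply, G_apply, Finset.sum_ite_eq']

lemma internalMul_G_apply {n : ℕ} (β σ : Perm (Fin n)) (g : FQSym K) :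
    internalMul (G K β) g ⟨n, σ⟩ = g ⟨n, σ * β⁻¹⟩ := by
  have cast_refl : (finCongr rfl).permCongr β = β := by ext; simp
  unfold internalMul G
  rw [Finsupp.sum_single_index (by simp [Finsupp.sum]), Finsupp.sum, Finsupp.finsetSum_apply,
    Finset.sum_eq_single ⟨n, σ * β⁻¹⟩]
  · rw [dif_pos rfl, cast_refl]
    simp
  · rintro ⟨m, τ⟩ _ hne
    by_cases h : n = m
    · subst h
      have hτ : τ * β ≠ σ := by
        rintro rfl
        simp at hne
      rw [dif_pos rfl, cast_refl]
      simp [hτ]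
    · simp [h]
  · intro h
    simp [Finsupp.notMem_support_iff.1 h]

lemma pairing_F {n : ℕ} (σ : Perm (Fin n)) (g : FQSym K) : pairing (F K σ) g = g ⟨n, σ⟩ := by
  simp [pairing, F, G]

lemma specX_eq_linearCombination (t : K) (f : FQSym K) :
    specX t f = Finsupp.linearCombination K
      (fun a : Σ n : ℕ, Perm (Fin n) => evalGeom (gesselF K ℕᵒᵈ a.2⁻¹))
      (Finsupp.linearCombination K (fun a : Σ n : ℕ, Perm (Fin n) =>
        ∑ β : Perm (Fin a.1), pairing (F K a.2⁻¹) (GOneSub t β) • F K β) f) := rfl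

lemma specX_F (t : K) {n : ℕ} (σ : Perm (Fin n)) :
    specX t (F K σ) =
      ∑ β : Perm (Fin n), SOneSub t n ⟨n, σ * β⁻¹⟩ • evalGeom (gesselF K ℕᵒᵈ β) := by
  rw [specX_eq_linearCombination, F, G, Finsupp.linearCombination_single, one_smul, map_sum]
  refine Finset.sum_congr rfl fun β _ => ?_
  rw [map_smul, pairing_F, GOneSub, internalMul_G_apply, F, G, Finsupp.linearCombination_single]
  simp

lemma specX_P (t : K) (T : BinaryTree Unit) :
    specX t (P K T) =
      ∑ σ : Perm (Fin T.numNodes) with bstShape σ = T, specX t (F K σ) := by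
  simp only [specX_eq_linearCombination, P, map_sum]

end Coordinates

section SignedLetters

/-- The letter `v` of an ordered alphabet `V`, barred if `b = true`. Barred letters precede the
other ones, and their order is reversed. -/
def signed {V : Type*} (b : Bool) (v : V) : Vᵒᵈ ⊕ₗ V :=
  if b then Sum.inlₗ (OrderDual.toDual v) else Sum.inrₗ v

/-- The sign of a letter in `σ_1((1 - t)A)`: `-t` if it is barred, and `1` otherwise. -/
def sign {K : Type*} [CommRing K] (t : K) (b : Bool) : K := if b then -t else 1

lemma map_sign {K K' : Type*} [CommRing K] [CommRing K'] (f : K →+* K') (t : K) (b : Bool) :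
    f (sign t b) = sign (f t) b := by
  cases b <;> simp [sign]

lemma eq_of_signed_eq_signed {V : Type*} {u v : V} {a b : Bool} (h : signed a u = signed b v) :
    u = v := by
  cases a <;> cases b <;> simp_all [signed]

variable {V : Type*} [LinearOrder V] {u v : V}

lemma signed_lt_signed_of_lt (h : u < v) (a b : Bool) : signed a u < signed b v ↔ b = false := by
  cases a <;> cases b <;> simp [signed, h, h.le]

lemma signed_lt_signed_of_gt (h : v < u) (a b : Bool) : signed a u < signed b v ↔ a = true := by
  cases a <;> cases b <;> simp [signed, h, h.le]

lemma antitone_of_strictMono_signed {n : ℕ} {τ : Fin n → V} {ε : Fin n → Bool}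
    (h : StrictMono fun i => signed (ε i) (τ i)) : Antitone ε := by
  refine antitone_iff_forall_lt.2 fun i j hij => Bool.le_iff_imp.2 fun hj => ?_
  by_contra hi
  simpa [signed, hj, hi] using h hij

end SignedLetters

section Words

variable {K : Type*} [CommRing K]

lemma strictMono_signed_decide_iff {k l : ℕ} {V : Type*} [LinearOrder V] (γ : Fin (k + l) → V) :
    StrictMono (fun i : Fin (k + l) => signed (decide ((i : ℕ) < k)) (γ i)) ↔
      StrictAnti (γ ∘ Fin.castAdd l) ∧ StrictMono (γ ∘ Fin.natAdd k) := by
  refine ⟨fun h => ⟨fun i j hij => ?_, fun i j hij => ?_⟩, fun h => ?_⟩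
  · simpa [signed] using h ((Fin.strictMono_castAdd l) hij)
  · simpa [signed] using h ((Fin.strictMono_natAdd k) hij)
  · simp only [StrictMono, Fin.forall_fin_add]
    refine ⟨fun i => ⟨fun j hij => ?_, fun j _ => ?_⟩, fun i => ⟨fun j hij => ?_, fun j hij => ?_⟩⟩
    · simpa [signed] using h.1 ((Fin.strictMono_castAdd l).lt_iff_lt.1 hij)
    · simp [signed]
    · exact absurd hij (by simp [Fin.lt_def]; omega)
    · simpa [signed] using h.2 ((Fin.strictMono_natAdd k).lt_iff_lt.1 hij)

lemma isConvolution_revPerm_one_iff {k l : ℕ} (γ : Perm (Fin (k + l))) :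
    IsConvolution Fin.revPerm 1 γ ↔
      StrictAnti (γ ∘ Fin.castAdd l) ∧ StrictMono (γ ∘ Fin.natAdd k) := by
  refine ⟨fun h => ⟨fun i j hij => (h.1 j i).2 ?_, fun i j hij => (h.2 i j).2 hij⟩,
    fun h => ⟨fun i j => ?_, fun i j => h.2.lt_iff_lt⟩⟩
  · simpa using hij
  · simpa using h.1.lt_iff_gt

open Classical in
lemma mul_Lam_S_apply {n k l : ℕ} (h : k + l = n) (τ : Perm (Fin n)) :
    mul (Lam K k) (S K l) ⟨n, τ⟩ =
      if StrictMono (fun i : Fin n => signed (decide ((i : ℕ) < k)) (τ i)) then 1 else 0 := by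
  subst h
  simp only [Lam, S, mul_G_G_apply, isConvolution_revPerm_one_iff, strictMono_signed_decide_iff]

lemma card_filter_decide_lt {n k : ℕ} (hk : k ≤ n) :
    Finset.card {i : Fin n | decide ((i : ℕ) < k) = true} = k := by
  simp [Fin.card_filter_val_lt, hk]

lemma prod_sign_decide_lt (t : K) {n k : ℕ} (hk : k ≤ n) :
    ∏ i : Fin n, sign t (decide ((i : ℕ) < k)) = (-t) ^ k := by
  simp only [sign, Finset.prod_ite, Finset.prod_const, one_pow, mul_one,
    card_filter_decide_lt hk]

lemma decide_lt_card_of_antitone {n : ℕ} {ε : Fin n → Bool} (h : Antitone ε) (i : Fin n) :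
    decide ((i : ℕ) < Finset.card {j | ε j = true}) = ε i := by
  have := Tuple.lt_card_ge_iff_apply_ge_of_antitone (j := i) (a := true) h
  simp only [Bool.le_iff_imp, forall_const] at this
  rw [Bool.eq_iff_iff, decide_eq_true_iff, this]

open Classical in
lemma SOneSub_apply (t : K) {n : ℕ} (τ : Perm (Fin n)) :
    SOneSub t n ⟨n, τ⟩ = ∑ ε : Fin n → Bool,
      if StrictMono (fun i => signed (ε i) (τ i)) then ∏ i, sign t (ε i) else 0 := by
  rw [SOneSub, Finsupp.finsetSum_apply]
  refine Finset.sum_of_injOn (fun p i => decide ((i : ℕ) < p.1)) ?_ (by simp)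
    (fun ε _ hε => if_neg fun h => hε ?_) fun p hp => ?_
  · intro p hp p' hp' h
    rw [Finset.mem_coe] at hp hp'
    have hcard := congrArg (fun ε : Fin n → Bool => Finset.card {i | ε i = true}) h
    simp only [card_filter_decide_lt (Finset.HasAntidiagonal.antidiagonal.fst_le hp),
      card_filter_decide_lt (Finset.HasAntidiagonal.antidiagonal.fst_le hp')] at hcard
    exact (Finset.HasAntidiagonal.antidiagonal_congr hp hp').2 hcard
  · have hk : Finset.card {j | ε j = true} ≤ n := (Finset.card_filter_le _ _).trans_eq (by simp)
    exact ⟨(_, n - Finset.card {j | ε j = true}),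
      Finset.HasAntidiagonal.mem_antidiagonal.2 (Nat.add_sub_cancel' hk),
      funext (decide_lt_card_of_antitone (antitone_of_strictMono_signed h))⟩
  · rw [Finsupp.smul_apply, mul_Lam_S_apply (Finset.HasAntidiagonal.mem_antidiagonal.1 hp),
      prod_sign_decide_lt t (Finset.HasAntidiagonal.antidiagonal.fst_le hp), smul_eq_mul, mul_ite,
      mul_one, mul_zero]

end Words

section Sorting

variable {n : ℕ} {L : Type*} [LinearOrder L] {κ : Fin n → L}

lemma strictMono_comp_iff_eq_sort (hκ : Function.Injective κ) (σ : Perm (Fin n)) :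
    StrictMono (κ ∘ σ) ↔ σ = Tuple.sort κ := by
  rw [Tuple.eq_sort_iff]
  exact ⟨fun h => ⟨h.monotone, fun i j hij he => absurd he (h hij).ne⟩,
    fun h => h.1.strictMono_of_injective (hκ.comp σ.injective)⟩

lemma strictMono_comp_sort (hκ : Function.Injective κ) : StrictMono (κ ∘ Tuple.sort κ) :=
  (strictMono_comp_iff_eq_sort hκ _).2 rfl

lemma sort_inv_lt_sort_inv_iff (hκ : Function.Injective κ) (i j : Fin n) :
    (Tuple.sort κ)⁻¹ i < (Tuple.sort κ)⁻¹ j ↔ κ i < κ j := by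
  simp [← (strictMono_comp_sort hκ).lt_iff_lt]

open Classical in
lemma sum_ite_strictMono_comp {M : Type*} [AddCommMonoid M] (hκ : Function.Injective κ)
    (f : Perm (Fin n) → M) :
    ∑ σ : Perm (Fin n), (if StrictMono (κ ∘ σ) then f σ else 0) = f (Tuple.sort κ) := by
  simp only [strictMono_comp_iff_eq_sort hκ, Finset.sum_ite_eq', Finset.mem_univ, if_true]

end Sorting

section FundamentalBasis

variable {K : Type*} [CommRing K]

lemma injective_signed_comp {V : Type*} {n : ℕ} {σ : Fin n → V} (hσ : Function.Injective σ)
    (δ : Fin n → Bool) : Function.Injective fun i => signed (δ i) (σ i) :=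
  fun _ _ h => hσ (eq_of_signed_eq_signed h)

open Classical in
lemma SOneSub_mul_inv_apply (t : K) {n : ℕ} (σ β : Perm (Fin n)) :
    SOneSub t n ⟨n, σ * β⁻¹⟩ = ∑ δ : Fin n → Bool,
      if StrictMono ((fun i => signed (δ i) (σ i)) ∘ ⇑β⁻¹) then ∏ i, sign t (δ i) else 0 := by
  rw [SOneSub_apply]
  refine Fintype.sum_equiv (β.symm.arrowCongr (Equiv.refl Bool)) _ _ fun ε => ?_
  refine if_congr (iff_of_eq (congrArg StrictMono (funext fun i => ?_))) ?_ rfl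
  · simp
  · exact (Equiv.prod_comp β fun i => sign t (ε i)).symm

lemma specX_F_eq_sum_sort (t : K) {n : ℕ} (σ : Perm (Fin n)) :
    specX t (F K σ) = ∑ δ : Fin n → Bool, (∏ i, sign (PowerSeries.C t) (δ i)) *
      evalGeom (gesselF K ℕᵒᵈ (Tuple.sort fun i => signed (δ i) (σ i))⁻¹) := by
  classical
  simp only [specX_F, SOneSub_mul_inv_apply, Finset.sum_smul, ite_smul, zero_smul,
    ← map_sign, ← map_prod, ← PowerSeries.smul_eq_C_mul]
  rw [Finset.sum_comm]
  refine Finset.sum_congr rfl fun δ _ => ?_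
  rw [← sum_ite_strictMono_comp (injective_signed_comp σ.injective δ)
    fun β => (∏ i, sign t (δ i)) • evalGeom (gesselF K ℕᵒᵈ β⁻¹)]
  exact Fintype.sum_equiv (Equiv.inv _) _ _ fun β => by simp

end FundamentalBasis

section Gessel

variable {K : Type*} [CommRing K]

lemma strictMono_toLex_iff {ι : Type*} [LinearOrder ι] {n : ℕ} (β : Perm (Fin n)) (s : Fin n → ι) :
    StrictMono (fun i => toLex (s i, β i)) ↔
      Monotone s ∧ ∀ i j : Fin n, (j : ℕ) = i + 1 → β j < β i → s i < s j := by
  refine ⟨fun h => ⟨Prod.Lex.monotone_fst_ofLex.comp h.monotone, fun i j hij hβ => ?_⟩,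
    fun ⟨hs, hs'⟩ => ?_⟩
  · have hlt := h (show i < j by simp [Fin.lt_def, hij])
    exact (Prod.Lex.toLex_lt_toLex.1 hlt).resolve_right fun h => h.2.not_gt hβ
  · cases n with
    | zero => exact fun i => i.elim0
    | succ n =>
      refine Fin.strictMono_iff_lt_succ.2 fun i => Prod.Lex.toLex_lt_toLex.2 ?_
      have hle := hs (Fin.castSucc_lt_succ (i := i)).le
      refine hle.lt_or_eq.imp_right fun he => ⟨he, ?_⟩
      have hne : β i.castSucc ≠ β i.succ := β.injective.ne (Fin.castSucc_lt_succ (i := i)).ne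
      exact hne.lt_of_le (not_lt.1 fun hβ => (hs' _ _ (by simp) hβ).ne he)

lemma finsum_cond_ncard_fiber {α γ : Type*} {p : α → Prop} {r : γ → Prop} {c : α → γ}
    (hfin : {a | p a ∧ r (c a)}.Finite) :
    ∑ᶠ (m) (_ : r m), ({a | p a ∧ c a = m}.ncard : K) = ({a | p a ∧ r (c a)}.ncard : K) := by
  classical
  rw [finsum_cond_eq_sum_of_cond_iff (t := hfin.toFinset.image c),
    Set.ncard_eq_toFinset_card _ hfin, Finset.card_eq_sum_card_image c, Nat.cast_sum]
  · refine Finset.sum_congr rfl fun m hm => congrArg Nat.cast ?_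
    rw [← Set.ncard_coe_finset]
    congr 1
    ext a
    simp only [Finset.mem_image, Set.Finite.mem_toFinset] at hm
    obtain ⟨b, hb, rfl⟩ := hm
    simp only [Finset.coe_filter, Set.Finite.mem_toFinset]
    exact ⟨fun ⟨ha, he⟩ => ⟨⟨ha, he ▸ hb.2⟩, he⟩, fun ⟨⟨ha, _⟩, he⟩ => ⟨ha, he⟩⟩
  · intro m hm
    obtain ⟨a, ha, rfl⟩ := Set.nonempty_of_ncard_ne_zero fun h => hm (by rw [h, Nat.cast_zero])
    simp only [Finset.mem_image, Set.Finite.mem_toFinset]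
    exact ⟨fun h => ⟨a, ⟨ha, h⟩, rfl⟩, fun ⟨b, hb, he⟩ => he ▸ hb.2⟩

lemma sum_ofDual_content {n : ℕ} (s : Fin n → ℕᵒᵈ) :
    ((∑ i, Finsupp.single (s i) 1 : ℕᵒᵈ →₀ ℕ).sum fun i a => OrderDual.ofDual i * a) =
      ∑ i, OrderDual.ofDual (s i) := by
  rw [← Finsupp.sum_finsetSum_index (by simp) (by intros; simp [mul_add])]
  simp

lemma finite_sum_ofDual_eq (n N : ℕ) :
    {s : Fin n → ℕᵒᵈ | ∑ i, OrderDual.ofDual (s i) = N}.Finite := by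
  refine (Set.finite_Ici fun _ : Fin n => OrderDual.toDual N).subset fun s hs i => ?_
  exact (Finset.single_le_sum (f := fun i => OrderDual.ofDual (s i))
    (fun _ _ => Nat.zero_le _) (Finset.mem_univ i)).trans_eq hs

lemma coeff_evalGeom_gesselF {n : ℕ} (β : Perm (Fin n)) (N : ℕ) :
    PowerSeries.coeff N (evalGeom (gesselF K ℕᵒᵈ β)) =
      (Set.ncard {s : Fin n → ℕᵒᵈ | StrictMono (fun i => toLex (s i, β i)) ∧
        ∑ i, OrderDual.ofDual (s i) = N} : K) := by
  simp only [strictMono_toLex_iff, ← sum_ofDual_content]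
  rw [evalGeom, PowerSeries.coeff_mk]
  refine Eq.trans ?_ (finsum_cond_ncard_fiber
    (r := fun m : ℕᵒᵈ →₀ ℕ => (m.sum fun i a => OrderDual.ofDual i * a) = N)
    (c := fun s : Fin n → ℕᵒᵈ => ∑ i, Finsupp.single (s i) 1)
    ((finite_sum_ofDual_eq n N).subset fun s hs => (sum_ofDual_content s).symm.trans hs.2))
  simp only [and_assoc]
  rfl

lemma ncard_strictMono_toLex_fin {n m N : ℕ} (hN : N < m) (β : Perm (Fin n)) :
    Set.ncard {s : Fin n → ℕᵒᵈ | StrictMono (fun i => toLex (s i, β i)) ∧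
        ∑ i, OrderDual.ofDual (s i) = N} =
      Set.ncard {a : Fin n → Fin m | StrictMono (fun i => toLex (OrderDual.toDual (a i), β i)) ∧
        ∑ i, (a i : ℕ) = N} := by
  symm
  refine Set.ncard_congr (fun a _ i => OrderDual.toDual (a i : ℕ)) (fun a ha => ?_)
    (fun a b _ _ hab => funext fun i => Fin.ext (congrFun hab i)) fun s hs => ?_
  · refine ⟨fun i j hij => ?_, ha.2⟩
    simpa [Prod.Lex.toLex_lt_toLex, Fin.val_inj] using ha.1 hij
  · have hlt : ∀ i, OrderDual.ofDual (s i) < m := fun i =>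
      ((Finset.single_le_sum (f := fun i => OrderDual.ofDual (s i))
        (fun _ _ => Nat.zero_le _) (Finset.mem_univ i)).trans_eq hs.2).trans_lt hN
    refine ⟨fun i => ⟨OrderDual.ofDual (s i), hlt i⟩, ⟨fun i j hij => ?_, hs.2⟩, rfl⟩
    simpa [Prod.Lex.toLex_lt_toLex] using hs.1 hij

open Classical in
lemma evalGeom_gesselF_sModEq {n : ℕ} (β : Perm (Fin n)) (m : ℕ) :
    evalGeom (gesselF K ℕᵒᵈ β) ≡ ∑ a : Fin n → Fin m,
      (if StrictMono fun i => toLex (OrderDual.toDual (a i), β i) then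
        ∏ i, (PowerSeries.X : PowerSeries K) ^ (a i : ℕ) else 0)
      [SMOD Ideal.span {(PowerSeries.X : PowerSeries K) ^ m}] := by
  rw [SModEq.sub_mem, Ideal.mem_span_singleton, PowerSeries.X_pow_dvd_iff]
  intro N hN
  rw [map_sub, coeff_evalGeom_gesselF, ncard_strictMono_toLex_fin hN, sub_eq_zero, map_sum,
    Set.ncard_eq_toFinset_card', Set.toFinset_ofPred, Finset.natCast_card_filter]
  refine Finset.sum_congr rfl fun a _ => ?_
  simp only [Finset.prod_pow_eq_pow_sum, apply_ite (PowerSeries.coeff N), map_zero,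
    PowerSeries.coeff_X_pow, eq_comm (a := N), ite_and]

end Gessel

section Keys

variable {m : ℕ}

/-- The sort key of the letter `v` carrying the label `x = (j, b)`: letters with a larger exponent
`j` come first, and letters with the same exponent are compared as signed letters, the bar being
`b`. -/
def key {V : Type*} (v : V) (x : Fin m × Bool) : (Fin m)ᵒᵈ ×ₗ (Vᵒᵈ ⊕ₗ V) :=
  toLex (OrderDual.toDual x.1, signed x.2 v)

/-- The contribution `q^j` or `-t q^j` of the label `(j, b)` of a letter. -/
def weight {R : Type*} [CommRing R] (q t : R) (x : Fin m × Bool) : R := q ^ (x.1 : ℕ) * sign t x.2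

lemma eq_of_key_eq_key {V : Type*} {u v : V} {x y : Fin m × Bool} (h : key u x = key v y) :
    u = v :=
  eq_of_signed_eq_signed (congrArg (fun k => (ofLex k).2) h)

variable {V : Type*} [LinearOrder V] {u v : V} (x y : Fin m × Bool)

lemma key_lt_key_of_lt (h : u < v) :
    key u x < key v y ↔ (y.1 : ℕ) + (if y.2 then 1 else 0) ≤ x.1 := by
  obtain ⟨⟨i, hi⟩, a⟩ := x
  obtain ⟨⟨j, hj⟩, b⟩ := y
  rw [key, key, Prod.Lex.toLex_lt_toLex, signed_lt_signed_of_lt h]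
  cases b
  · simp [le_iff_lt_or_eq, eq_comm]
  · simp

lemma key_lt_key_of_gt (h : v < u) :
    key u x < key v y ↔ (if x.2 then (y.1 : ℕ) else y.1 + 1) ≤ x.1 := by
  obtain ⟨⟨i, hi⟩, a⟩ := x
  obtain ⟨⟨j, hj⟩, b⟩ := y
  rw [key, key, Prod.Lex.toLex_lt_toLex, signed_lt_signed_of_gt h]
  cases a
  · simp
  · simp [le_iff_lt_or_eq, eq_comm]

end Keys

section LabelledWords

variable {K : Type*} [CommRing K]

lemma strictMono_toLex_sort_inv_iff {n m : ℕ} {V : Type*} [LinearOrder V] {σ : Fin n → V}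
    (hσ : Function.Injective σ) (w : Fin n → Fin m × Bool) :
    StrictMono (fun i => toLex (OrderDual.toDual (w i).1,
        (Tuple.sort fun i => signed (w i).2 (σ i))⁻¹ i)) ↔
      StrictMono fun i => key (σ i) (w i) := by
  simp only [StrictMono, key, Prod.Lex.toLex_lt_toLex,
    sort_inv_lt_sort_inv_iff (injective_signed_comp hσ _)]

open Classical in
lemma specX_F_sModEq (t : K) {n : ℕ} (σ : Perm (Fin n)) (m : ℕ) :
    specX t (F K σ) ≡ ∑ w : Fin n → Fin m × Bool,
      (if StrictMono fun i => key (σ i) (w i) then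
        ∏ i, weight (PowerSeries.X : PowerSeries K) (PowerSeries.C t) (w i) else 0)
      [SMOD Ideal.span {(PowerSeries.X : PowerSeries K) ^ m}] := by
  rw [specX_F_eq_sum_sort,
    ← (Equiv.arrowProdEquivProdArrow (Fin n) (fun _ => Fin m) fun _ => Bool).symm.sum_comp,
    Fintype.sum_prod_type_right]
  refine SModEq.sum fun δ _ => ?_
  refine (SModEq.mul (SModEq.refl (∏ i, sign (PowerSeries.C t) (δ i)))
    (evalGeom_gesselF_sModEq _ m)).trans ?_
  rw [Finset.mul_sum]
  refine SModEq.sum fun a _ => ?_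
  rw [mul_ite, mul_zero, ← Finset.prod_mul_distrib]
  simp only [strictMono_toLex_sort_inv_iff σ.injective (fun i => (a i, δ i)),
    Equiv.arrowProdEquivProdArrow, Equiv.coe_fn_symm_mk, weight, mul_comm]
  rfl

end LabelledWords

section DecreasingTrees

section InfixOrder

variable (e : Unit) (l r : BinaryTree Unit)

/-- The rank, in the infix order of the nodes of a tree, of the `i`-th node of its left subtree. -/
def infixLeft (i : Fin l.numNodes) : Fin (BinaryTree.node e l r).numNodes :=
  ⟨i, by rw [BinaryTree.numNodes]; omega⟩

/-- The rank of the root of a tree in the infix order of its nodes. -/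
def infixRoot : Fin (BinaryTree.node e l r).numNodes :=
  ⟨l.numNodes, by rw [BinaryTree.numNodes]; omega⟩

/-- The rank, in the infix order of the nodes of a tree, of the `i`-th node of its right
subtree. -/
def infixRight (i : Fin r.numNodes) : Fin (BinaryTree.node e l r).numNodes :=
  ⟨l.numNodes + 1 + i, by rw [BinaryTree.numNodes]; omega⟩

end InfixOrder

/-- The labels `κ 0, κ 1, …`, placed at the nodes of `T` in infix order, form a decreasing tree:
the label of each node is larger than all the other labels of its subtree. -/
def IsDecreasing {L : Type*} [LT L] : (T : BinaryTree Unit) → (Fin T.numNodes → L) → Prop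
  | .nil, _ => True
  | .node e l r, κ =>
    ((∀ i, κ (infixLeft e l r i) < κ (infixRoot e l r)) ∧
        ∀ i, κ (infixRight e l r i) < κ (infixRoot e l r)) ∧
      IsDecreasing l (fun i => κ (infixLeft e l r i)) ∧
      IsDecreasing r fun i => κ (infixRight e l r i)

lemma isDecreasing_congr {L L' : Type*} [LT L] [LT L'] {T : BinaryTree Unit}
    {κ : Fin T.numNodes → L} {κ' : Fin T.numNodes → L'} (h : ∀ i j, κ i < κ j ↔ κ' i < κ' j) :
    IsDecreasing T κ ↔ IsDecreasing T κ' := by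
  induction T with
  | nil => exact Iff.rfl
  | node _ l r hl hr =>
    simp only [IsDecreasing, h]
    exact and_congr_right' (and_congr (hl fun _ _ => h _ _) (hr fun _ _ => h _ _))

end DecreasingTrees

section BinarySearchTrees

lemma foldr_bstInsert_concat (w : List ℕ) (y : ℕ) :
    (w ++ [y]).foldr bstInsert .nil =
      .node y ((w.filter (· ≤ y)).foldr bstInsert .nil)
        ((w.filter (y < ·)).foldr bstInsert .nil) := by
  induction w with
  | nil => simp [bstInsert]
  | cons x w ih =>
    rw [List.cons_append, List.foldr_cons, ih, bstInsert]
    by_cases h : x ≤ y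
    · simp [h]
    · simp [h, not_le.1 h]

lemma numNodes_bstInsert (x : ℕ) (T : BinaryTree ℕ) :
    (bstInsert x T).numNodes = T.numNodes + 1 := by
  induction T with
  | nil => rfl
  | node y l r hl hr =>
    rw [bstInsert]
    split_ifs <;> simp only [BinaryTree.numNodes, hl, hr] <;> omega

lemma numNodes_foldr_bstInsert (w : List ℕ) :
    (w.foldr bstInsert .nil).numNodes = w.length := by
  induction w with
  | nil => rfl
  | cons x w ih => rw [List.foldr_cons, numNodes_bstInsert, ih, List.length_cons]

lemma numNodes_map {α β : Type*} (f : α → β) (T : BinaryTree α) :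
    (T.map f).numNodes = T.numNodes := by
  induction T with
  | nil => rfl
  | node y l r hl hr => simp only [BinaryTree.map, BinaryTree.numNodes, hl, hr]

lemma length_eq_of_mem_iff {w : List ℕ} (hw : w.Nodup) {a b : ℕ}
    (h : ∀ v, v ∈ w ↔ a ≤ v ∧ v < b) : w.length = b - a := by
  rw [← List.toFinset_card_of_nodup hw, ← Nat.card_Ico]
  congr 1
  ext v
  simp [h]

lemma mem_filter_le_iff_of_mem_concat_iff {w : List ℕ} {y a b : ℕ} (hw : (w ++ [y]).Nodup)
    (h : ∀ v, v ∈ w ++ [y] ↔ a ≤ v ∧ v < b) (v : ℕ) :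
    v ∈ w.filter (· ≤ y) ↔ a ≤ v ∧ v < y := by
  have hy : y ∉ w := fun hy => (List.nodup_append.1 hw).2.2 y hy y (by simp) rfl
  have := h v
  have := h y
  grind

lemma mem_filter_gt_iff_of_mem_concat_iff {w : List ℕ} {y a b : ℕ} (hw : (w ++ [y]).Nodup)
    (h : ∀ v, v ∈ w ++ [y] ↔ a ≤ v ∧ v < b) (v : ℕ) :
    v ∈ w.filter (y < ·) ↔ y + 1 ≤ v ∧ v < b := by
  have hy : y ∉ w := fun hy => (List.nodup_append.1 hw).2.2 y hy y (by simp) rfl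
  have := h v
  have := h y
  grind

lemma eq_root_of_isDecreasing {L : Type*} [Preorder L] {κ : ℕ → L}
    {l r : BinaryTree Unit} {o y : ℕ} (hy : o ≤ y ∧ y < o + (BinaryTree.node () l r).numNodes)
    (hmax : ∀ v, o ≤ v → v < o + (BinaryTree.node () l r).numNodes → v ≠ y → κ v < κ y)
    (h : IsDecreasing (.node () l r) fun i => κ (o + i)) : y = o + l.numNodes := by
  simp only [BinaryTree.numNodes] at hy hmax
  by_contra hroot
  have hroot_lt := hmax (o + l.numNodes) (by omega) (by omega) (Ne.symm hroot)
  obtain hlt | hgt := Ne.lt_or_gt hroot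
  · have hy_lt := h.1.1 ⟨y - o, by omega⟩
    simp only [infixLeft, infixRoot, Nat.add_sub_cancel' hy.1] at hy_lt
    exact hy_lt.not_gt hroot_lt
  · have hy_lt := h.1.2 ⟨y - (o + l.numNodes + 1), by omega⟩
    simp only [infixRight, infixRoot,
      show o + (l.numNodes + 1 + (y - (o + l.numNodes + 1))) = y by omega] at hy_lt
    exact hy_lt.not_gt hroot_lt

lemma map_foldr_bstInsert_eq_iff {L : Type*} [Preorder L] (κ : ℕ → L) (T : BinaryTree Unit) :
    ∀ (o : ℕ) (w : List ℕ), w.Pairwise (fun u v => κ u < κ v) →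
      (∀ v, v ∈ w ↔ o ≤ v ∧ v < o + T.numNodes) →
      ((w.foldr bstInsert .nil).map (fun _ => ()) = T ↔ IsDecreasing T fun i => κ (o + i)) := by
  induction T with
  | nil =>
    intro o w _ hmem
    obtain rfl : w = [] := List.eq_nil_iff_forall_not_mem.2 fun v hv =>
      ((hmem v).1 hv).1.not_gt ((hmem v).1 hv).2
    exact iff_of_true rfl trivial
  | node _ l r hl hr =>
    intro o w hw hmem
    have hnodup : w.Nodup := hw.imp fun h => ne_of_apply_ne κ h.ne
    simp only [BinaryTree.numNodes] at hmem
    obtain rfl | ⟨w, y, rfl⟩ := w.eq_nil_or_concat'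
    · simpa using (hmem o).2 (by omega)
    have hmem₁ := mem_filter_le_iff_of_mem_concat_iff hnodup hmem
    have hmem₂ := mem_filter_gt_iff_of_mem_concat_iff hnodup hmem
    have hw' : w.Pairwise fun u v => κ u < κ v := (List.pairwise_append.1 hw).1
    have hmax : ∀ v, o ≤ v → v < o + (l.numNodes + r.numNodes + 1) → v ≠ y → κ v < κ y := by
      intro v hv hv' hne
      have : v ∈ w := by simpa [hne] using (hmem v).2 ⟨hv, hv'⟩
      exact (List.pairwise_append.1 hw).2.2 v this y (List.mem_singleton_self y)
    have hy := (hmem y).1 (by simp)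
    rw [foldr_bstInsert_concat, BinaryTree.map, BinaryTree.node.injEq, IsDecreasing]
    simp only [infixLeft, infixRoot, infixRight]
    by_cases hroot : y = o + l.numNodes
    · subst hroot
      rw [hl o _ (hw'.filter _) hmem₁,
        hr (o + l.numNodes + 1) _ (hw'.filter _) fun v => (hmem₂ v).trans (by omega)]
      have hmaxl (i : Fin l.numNodes) : κ (o + i) < κ (o + l.numNodes) :=
        hmax _ (by omega) (by omega) (by omega)
      have hmaxr (i : Fin r.numNodes) : κ (o + l.numNodes + 1 + i) < κ (o + l.numNodes) :=
        hmax _ (by omega) (by omega) (by omega)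
      simp only [hmaxl, hmaxr, implies_true, true_and, ← add_assoc]
    · refine iff_of_false (fun h => hroot ?_) fun h => hroot (eq_root_of_isDecreasing hy hmax h)
      have := congrArg BinaryTree.numNodes h.2.1
      rw [numNodes_map, numNodes_foldr_bstInsert,
        length_eq_of_mem_iff ((List.nodup_append.1 hnodup).1.filter _) hmem₁] at this
      omega

lemma bstShape_eq_iff (T : BinaryTree Unit) (σ : Perm (Fin T.numNodes)) :
    bstShape σ = T ↔ IsDecreasing T ⇑σ⁻¹ := by
  let κ : ℕ → ℕ := fun v => if h : v < T.numNodes then (σ⁻¹ ⟨v, h⟩ : ℕ) else 0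
  have hκ (i : Fin T.numNodes) : κ (0 + i) = (σ⁻¹ i : ℕ) := by simp [κ]
  rw [← isDecreasing_congr (κ := fun i => κ (0 + i)) fun i j => by rw [hκ, hκ, Fin.lt_def]]
  refine map_foldr_bstInsert_eq_iff κ T 0 _ ?_ fun v => ?_
  · rw [List.pairwise_ofFn]
    intro i j hij
    simpa [κ] using hij
  · rw [List.mem_ofFn]
    exact ⟨by rintro ⟨i, rfl⟩; simp, fun hv => ⟨σ⁻¹ ⟨v, by omega⟩, by simp⟩⟩

lemma bstShape_eq_iff_of_strictMono_comp {L : Type*} [Preorder L] {T : BinaryTree Unit}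
    {σ : Perm (Fin T.numNodes)} {κ : Fin T.numNodes → L} (h : StrictMono (κ ∘ σ)) :
    bstShape σ = T ↔ IsDecreasing T κ := by
  rw [bstShape_eq_iff]
  exact isDecreasing_congr fun i j => by simpa using (h.lt_iff_lt (a := σ⁻¹ i) (b := σ⁻¹ j)).symm

end BinarySearchTrees

section NodeLabellings

variable {X : Type*} {l r : BinaryTree Unit} (e : Unit)

/-- The labelling of the nodes of a tree, numbered in infix order, made of a labelling `u` of its
left subtree, the label `x` of its root and a labelling `v` of its right subtree. -/
def nodeLabelling (u : Fin l.numNodes → X) (x : X) (v : Fin r.numNodes → X) :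
    Fin (BinaryTree.node e l r).numNodes → X :=
  Fin.append (n := r.numNodes + 1) u (Fin.cons x v)

lemma sum_eq_sum_nodeLabelling {M : Type*} [Fintype X] [AddCommMonoid M]
    (f : (Fin (BinaryTree.node e l r).numNodes → X) → M) :
    ∑ w, f w = ∑ x, ∑ u, ∑ v, f (nodeLabelling e u x v) := by
  rw [Finset.sum_comm]
  refine ((Fin.appendEquiv l.numNodes (r.numNodes + 1)).sum_comp f).symm.trans ?_
  rw [Fintype.sum_prod_type]
  refine Finset.sum_congr rfl fun u _ => ?_
  rw [← (Fin.consEquiv fun _ => X).sum_comp, Fintype.sum_prod_type]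
  rfl

variable (u : Fin l.numNodes → X) (x : X) (v : Fin r.numNodes → X)

lemma nodeLabelling_infixLeft (i : Fin l.numNodes) :
    nodeLabelling e u x v (infixLeft e l r i) = u i :=
  Fin.append_left (n := r.numNodes + 1) u (Fin.cons x v) i

lemma nodeLabelling_infixRoot : nodeLabelling e u x v (infixRoot e l r) = x :=
  Fin.append_right (n := r.numNodes + 1) u (Fin.cons x v) 0

lemma nodeLabelling_infixRight (i : Fin r.numNodes) :
    nodeLabelling e u x v (infixRight e l r i) = v i := by
  have hi : infixRight e l r i = Fin.natAdd l.numNodes i.succ := by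
    ext
    simp only [infixRight, Fin.val_natAdd, Fin.val_succ]
    omega
  rw [hi]
  exact Fin.append_right (n := r.numNodes + 1) u (Fin.cons x v) i.succ

lemma prod_nodeLabelling {M : Type*} [CommMonoid M] (f : X → M) :
    ∏ i, f (nodeLabelling e u x v i) = f x * (∏ i, f (u i)) * ∏ i, f (v i) := by
  refine (Fin.prod_univ_add (b := r.numNodes + 1) _).trans ?_
  simp [nodeLabelling, Fin.prod_univ_succ, mul_left_comm, mul_assoc]

lemma forall_nodeLabelling_iff (p : X → Prop) :
    (∀ i, p (nodeLabelling e u x v i)) ↔ p x ∧ (∀ i, p (u i)) ∧ ∀ i, p (v i) := by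
  refine (Fin.forall_fin_add (n := r.numNodes + 1) _).trans ?_
  simp [nodeLabelling, Fin.forall_fin_succ, and_left_comm]

end NodeLabellings

section TreeLabellings

variable {m : ℕ}

/-- The condition on a label `(j, b)` that `j` is at least `a` if the label is not barred, and at
least `a'` if it is. -/
def IsAbove (a a' : ℕ) (x : Fin m × Bool) : Prop := (if x.2 then a' else a) ≤ x.1

/-- The labellings of the nodes of `T`, numbered in infix order, whose keys form a decreasing tree
and whose labels are bounded below by `a` (unbarred labels) and `a'` (barred labels). -/
def IsDecreasingAbove (T : BinaryTree Unit) (a a' : ℕ) (w : Fin T.numNodes → Fin m × Bool) :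
    Prop :=
  (IsDecreasing T fun v => key v (w v)) ∧ ∀ v, IsAbove a a' (w v)

lemma key_lt_key_iff_of_strictMono {V V' : Type*} [LinearOrder V] [Preorder V'] {f : V → V'}
    (hf : StrictMono f) (u v : V) (x y : Fin m × Bool) :
    key (f u) x < key (f v) y ↔ key u x < key v y := by
  obtain ⟨i, a⟩ := x
  obtain ⟨j, b⟩ := y
  cases a <;> cases b <;> simp [key, signed, Prod.Lex.toLex_lt_toLex, hf.lt_iff_lt]

lemma isDecreasing_key_nodeLabelling_iff {e : Unit} {l r : BinaryTree Unit}
    (u : Fin l.numNodes → Fin m × Bool) (x : Fin m × Bool) (v : Fin r.numNodes → Fin m × Bool) :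
    (IsDecreasing (.node e l r) fun i => key i (nodeLabelling e u x v i)) ↔
      IsDecreasingAbove l (x.1 + if x.2 then 1 else 0) (x.1 + if x.2 then 1 else 0) u ∧
        IsDecreasingAbove r (x.1 + 1) x.1 v := by
  have hl (i : Fin l.numNodes) : infixLeft e l r i < infixRoot e l r := i.isLt
  have hr (i : Fin r.numNodes) : infixRoot e l r < infixRight e l r i := by
    simp only [infixRoot, infixRight, Fin.mk_lt_mk]
    omega
  have hleft : StrictMono (infixLeft e l r) := fun _ _ h => h
  have hright : StrictMono (infixRight e l r) := fun _ _ h => Nat.add_lt_add_left h _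
  simp only [IsDecreasingAbove, IsDecreasing, nodeLabelling_infixLeft, nodeLabelling_infixRoot,
    nodeLabelling_infixRight, key_lt_key_of_lt _ _ (hl _), key_lt_key_of_gt _ _ (hr _)]
  rw [isDecreasing_congr fun i j => key_lt_key_iff_of_strictMono hleft i j (u i) (u j),
    isDecreasing_congr fun i j => key_lt_key_iff_of_strictMono hright i j (v i) (v j)]
  simp only [IsAbove, ite_self]
  tauto

lemma isDecreasingAbove_nodeLabelling_iff {a a' : ℕ} (h : a' ≤ a) (h' : a ≤ a' + 1) {e : Unit}
    {l r : BinaryTree Unit} (u : Fin l.numNodes → Fin m × Bool) (x : Fin m × Bool)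
    (v : Fin r.numNodes → Fin m × Bool) :
    IsDecreasingAbove (.node e l r) a a' (nodeLabelling e u x v) ↔
      IsAbove a a' x ∧
      IsDecreasingAbove l (x.1 + if x.2 then 1 else 0) (x.1 + if x.2 then 1 else 0) u ∧
        IsDecreasingAbove r (x.1 + 1) x.1 v := by
  rw [IsDecreasingAbove, isDecreasing_key_nodeLabelling_iff, forall_nodeLabelling_iff]
  have hu (i : Fin l.numNodes) (hx : IsAbove a a' x)
      (hi : IsAbove (x.1 + if x.2 then 1 else 0) (x.1 + if x.2 then 1 else 0) (u i)) :
      IsAbove a a' (u i) := by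
    unfold IsAbove at *
    split_ifs at * <;> omega
  have hv (i : Fin r.numNodes) (hx : IsAbove a a' x) (hi : IsAbove (x.1 + 1) x.1 (v i)) :
      IsAbove a a' (v i) := by
    unfold IsAbove at *
    split_ifs at * <;> omega
  exact ⟨fun ⟨⟨hl, hr⟩, hx, _⟩ => ⟨hx, hl, hr⟩, fun ⟨hx, hl, hr⟩ =>
    ⟨⟨hl, hr⟩, hx, fun i => hu i hx (hl.2 i), fun i => hv i hx (hr.2 i)⟩⟩

open Classical in
/-- The sum of the weights of the labellings counted by `IsDecreasingAbove`. -/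
def labelSum {R : Type*} [CommRing R] (q t : R) (m : ℕ) (T : BinaryTree Unit) (a a' : ℕ) : R :=
  ∑ w : Fin T.numNodes → Fin m × Bool with IsDecreasingAbove T a a' w, ∏ v, weight q t (w v)

section

variable {R : Type*} [CommRing R] (q t : R) (m : ℕ)

@[simp]
lemma labelSum_nil (a a' : ℕ) : labelSum q t m .nil a a' = 1 := by
  simp only [labelSum, Finset.sum_filter]
  exact (Fintype.sum_unique (ι := Fin 0 → _) _).trans (if_pos ⟨trivial, fun i => i.elim0⟩)

open Classical in
lemma labelSum_node {a a' : ℕ} (h : a' ≤ a) (h' : a ≤ a' + 1) (e : Unit) (l r : BinaryTree Unit) :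
    labelSum q t m (.node e l r) a a' = ∑ x : Fin m × Bool with IsAbove a a' x,
      weight q t x *
        labelSum q t m l (x.1 + if x.2 then 1 else 0) (x.1 + if x.2 then 1 else 0) *
        labelSum q t m r (x.1 + 1) x.1 := by
  simp only [labelSum, Finset.sum_filter]
  refine (sum_eq_sum_nodeLabelling e _).trans (Finset.sum_congr rfl fun x _ => ?_)
  simp only [isDecreasingAbove_nodeLabelling_iff h h', prod_nodeLabelling]
  by_cases hx : IsAbove a a' x
  · simp only [hx, true_and, if_true, mul_assoc]
    rw [Finset.sum_mul_sum, Finset.mul_sum]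
    refine Finset.sum_congr rfl fun u _ => ?_
    rw [Finset.mul_sum]
    refine Finset.sum_congr rfl fun v _ => ?_
    rw [ite_zero_mul_ite_zero, mul_ite, mul_zero]
  · simp only [hx, false_and, if_false, Finset.sum_const_zero]

end

open Classical in
lemma sum_bstShape_strictMono_key {R : Type*} [CommRing R] (q t : R) (m : ℕ) (T : BinaryTree Unit) :
    ∑ σ : Perm (Fin T.numNodes) with bstShape σ = T, ∑ w : Fin T.numNodes → Fin m × Bool,
        (if StrictMono fun i => key (σ i) (w i) then ∏ i, weight q t (w i) else 0) =
      labelSum q t m T 0 0 := by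
  have habove (x : Fin m × Bool) : IsAbove 0 0 x := by simp [IsAbove]
  have hreindex (σ : Perm (Fin T.numNodes)) : ∑ w : Fin T.numNodes → Fin m × Bool,
        (if StrictMono fun i => key (σ i) (w i) then ∏ i, weight q t (w i) else 0) =
      ∑ w : Fin T.numNodes → Fin m × Bool,
        if StrictMono ((fun v => key v (w v)) ∘ σ) then ∏ v, weight q t (w v) else 0 := by
    rw [← (σ.symm.arrowCongr (Equiv.refl _)).sum_comp]
    refine Finset.sum_congr rfl fun w _ => if_congr Iff.rfl ?_ rfl
    exact Equiv.prod_comp σ fun v => weight q t (w v)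
  rw [Finset.sum_congr rfl fun σ _ => hreindex σ, Finset.sum_comm, labelSum, Finset.sum_filter]
  refine Finset.sum_congr rfl fun w _ => ?_
  have hw : Function.Injective fun v => key v (w v) := fun _ _ h => eq_of_key_eq_key h
  simp only [Finset.sum_filter, IsDecreasingAbove, habove, implies_true, and_true]
  have hswap (σ : Perm (Fin T.numNodes)) (y : R) :
      (if bstShape σ = T then if StrictMono ((fun v => key v (w v)) ∘ σ) then y else 0 else 0) =
        if StrictMono ((fun v => key v (w v)) ∘ σ) then if bstShape σ = T then y else 0 else 0 := by
    split_ifs <;> rfl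
  simp only [hswap]
  rw [sum_ite_strictMono_comp hw]
  exact if_congr (bstShape_eq_iff_of_strictMono_comp (strictMono_comp_sort hw)) rfl rfl

lemma specX_P_sModEq {K : Type*} [CommRing K] (t : K) (T : BinaryTree Unit) (m : ℕ) :
    specX t (P K T) ≡ labelSum PowerSeries.X (PowerSeries.C t) m T 0 0
      [SMOD Ideal.span {(PowerSeries.X : PowerSeries K) ^ m}] := by
  rw [specX_P, ← sum_bstShape_strictMono_key]
  exact SModEq.sum fun σ _ => specX_F_sModEq t σ m

end TreeLabellings

section HookProduct

variable {R : Type*} [CommRing R] (q t : R)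

/-- The product of the `(q,t)`-hook-contents of the nodes of a tree, except that the numerator of
the last node of the right branch starting at the root is replaced by `y`. In the recursion the
numerators are shifted by one node down each right branch: the root carries `y`, and a right son
carries the numerator of its father. Denominators are inverted in `R` by `Ring.inverse`. -/
def hookProduct : BinaryTree Unit → R → R
  | .nil, _ => 1
  | .node _ l r, y =>
    y * Ring.inverse (1 - q ^ (l.numNodes + r.numNodes + 1)) *
      hookProduct l (1 - q ^ l.left.numNodes * t) *
      hookProduct r (q ^ r.numNodes - q ^ r.left.numNodes * t)

lemma hookProduct_pow_numNodes_mul (x y : R) (T : BinaryTree Unit) :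
    hookProduct q t T (x ^ T.numNodes * y) = x ^ T.numNodes * hookProduct q t T y := by
  cases T with
  | nil => simp [hookProduct, BinaryTree.numNodes]
  | node e l r => simp only [hookProduct, mul_assoc]

lemma mul_hookProduct_comm (x y : R) {T : BinaryTree Unit} (hT : T ≠ .nil) :
    x * hookProduct q t T y = y * hookProduct q t T x := by
  cases T with
  | nil => exact absurd rfl hT
  | node e l r =>
    simp only [hookProduct]
    ring

variable {q} (hq : ∀ n, n ≠ 0 → IsUnit (1 - q ^ n)) {m : ℕ}

include hq in
lemma sum_Ico_pow_sModEq {n : ℕ} (hn : n ≠ 0) (a : ℕ) :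
    ∑ j ∈ Finset.Ico a m, (q ^ n) ^ j ≡ q ^ (a * n) * Ring.inverse (1 - q ^ n)
      [SMOD Ideal.span {q ^ m}] := by
  have pow_sModEq_zero {k : ℕ} (hk : m ≤ k) : q ^ k ≡ 0 [SMOD Ideal.span {q ^ m}] :=
    SModEq.zero.2 (Ideal.mem_span_singleton.2 (pow_dvd_pow q hk))
  have hgeom : (∑ j ∈ Finset.Ico a m, (q ^ n) ^ j) * (1 - q ^ n) ≡ q ^ (a * n)
      [SMOD Ideal.span {q ^ m}] := by
    rcases le_total a m with ham | hma
    · rw [geom_sum_Ico_mul_neg _ ham, ← pow_mul, ← pow_mul, mul_comm n a]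
      simpa using (SModEq.refl _).sub (pow_sModEq_zero (Nat.le_mul_of_pos_left m (by omega)))
    · rw [Finset.Ico_eq_empty_of_le hma, Finset.sum_empty, zero_mul]
      exact (pow_sModEq_zero (hma.trans (Nat.le_mul_of_pos_right a (by omega)))).symm
  have hdiv := hgeom.mul (SModEq.refl (Ring.inverse (1 - q ^ n)))
  rwa [mul_assoc, Ring.mul_inverse_cancel _ (hq n hn), mul_one] at hdiv

open Classical in
include hq in
lemma sum_weight_above_sModEq (a a' k l : ℕ) :
    ∑ x : Fin m × Bool with IsAbove a a' x,
        weight q t x * (q ^ ((x.1 : ℕ) + if x.2 then 1 else 0)) ^ k * (q ^ (x.1 : ℕ)) ^ l ≡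
      (q ^ (a * (k + l + 1)) - q ^ (a' * (k + l + 1) + k) * t) *
        Ring.inverse (1 - q ^ (k + l + 1)) [SMOD Ideal.span {q ^ m}] := by
  have hIco (f : ℕ → R) (b : ℕ) :
      ∑ j : Fin m, (if b ≤ j then f j else 0) = ∑ j ∈ Finset.Ico b m, f j := by
    rw [Fin.sum_univ_eq_sum_range fun j => if b ≤ j then f j else 0, ← Finset.sum_filter,
      Finset.range_eq_Ico, Finset.Ico_filter_le, max_eq_right b.zero_le]
  have hbool : ∑ x : Fin m × Bool with IsAbove a a' x,
        weight q t x * (q ^ ((x.1 : ℕ) + if x.2 then 1 else 0)) ^ k * (q ^ (x.1 : ℕ)) ^ l =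
      ∑ j ∈ Finset.Ico a m, (q ^ (k + l + 1)) ^ j -
        q ^ k * t * ∑ j ∈ Finset.Ico a' m, (q ^ (k + l + 1)) ^ j := by
    rw [← hIco, ← hIco, Finset.mul_sum, ← Finset.sum_sub_distrib, Finset.sum_filter,
      Fintype.sum_prod_type]
    refine Finset.sum_congr rfl fun j _ => ?_
    simp only [Fintype.sum_bool, IsAbove, weight, sign, if_true, Bool.false_eq_true, if_false]
    split_ifs <;> ring
  have hn : k + l + 1 ≠ 0 := (k + l).add_one_ne_zero
  rw [hbool]
  convert (sum_Ico_pow_sModEq hq (m := m) hn a).sub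
    ((SModEq.refl (q ^ k * t)).mul (sum_Ico_pow_sModEq hq (m := m) hn a')) using 1
  ring

include hq in
lemma labelSum_sModEq (T : BinaryTree Unit) {a a' : ℕ} (h : a' ≤ a) (h' : a ≤ a' + 1) :
    labelSum q t m T a a' ≡
      hookProduct q t T (q ^ (a * T.numNodes) - q ^ (a' * T.numNodes + T.left.numNodes) * t)
      [SMOD Ideal.span {q ^ m}] := by
  classical
  induction T generalizing a a' with
  | nil =>
    rw [labelSum_nil]
    rfl
  | node e l r hl hr =>
    rw [labelSum_node q t m h h']
    have hleft (c : ℕ) : labelSum q t m l c c ≡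
        (q ^ c) ^ l.numNodes * hookProduct q t l (1 - q ^ l.left.numNodes * t)
        [SMOD Ideal.span {q ^ m}] := by
      rw [← hookProduct_pow_numNodes_mul]
      convert hl le_rfl c.le_succ using 2
      ring
    have hright (j : ℕ) : labelSum q t m r (j + 1) j ≡
        (q ^ j) ^ r.numNodes *
          hookProduct q t r (q ^ r.numNodes - q ^ r.left.numNodes * t)
        [SMOD Ideal.span {q ^ m}] := by
      rw [← hookProduct_pow_numNodes_mul]
      convert hr (a := j + 1) j.le_succ le_rfl using 2
      ring
    refine (SModEq.sum fun x _ => (SModEq.rfl.mul (hleft _)).mul (hright _)).trans ?_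
    have hroot := sum_weight_above_sModEq t hq (m := m) a a' l.numNodes r.numNodes
    have hmul := (hroot.mul (SModEq.refl
      (hookProduct q t l (1 - q ^ l.left.numNodes * t)))).mul
      (SModEq.refl (hookProduct q t r (q ^ r.numNodes - q ^ r.left.numNodes * t)))
    rw [Finset.sum_mul, Finset.sum_mul] at hmul
    convert hmul using 1
    · exact Finset.sum_congr rfl fun x _ => by ring
    · simp only [hookProduct, BinaryTree.numNodes, BinaryTree.left]

end HookProduct

lemma map_hookProduct {R S : Type*} [CommRing R] [CommRing S] (φ : R →+* S) {q : R} (t : R)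
    (hq : ∀ n, n ≠ 0 → IsUnit (1 - q ^ n)) (T : BinaryTree Unit) (y : R) :
    φ (hookProduct q t T y) = hookProduct (φ q) (φ t) T (φ y) := by
  induction T generalizing y with
  | nil => exact map_one φ
  | node e l r hl hr =>
    have hunit := hq (l.numNodes + r.numNodes + 1) (Nat.add_one_ne_zero _)
    have hinv : φ (Ring.inverse (1 - q ^ (l.numNodes + r.numNodes + 1))) =
        Ring.inverse (1 - φ q ^ (l.numNodes + r.numNodes + 1)) := by
      rw [← map_pow, ← map_one φ, ← map_sub, ← one_mul (Ring.inverse (φ _)),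
        Ring.eq_mul_inverse_iff_mul_eq _ _ _ (hunit.map φ), ← map_mul,
        Ring.inverse_mul_cancel _ hunit, map_one]
    simp only [hookProduct, map_mul, hinv, hl, hr, map_sub, map_one, map_pow]

section Specialization

variable {K : Type*} [CommRing K]

lemma isUnit_one_sub_X_pow_mul_C (t : K) {n : ℕ} (hn : n ≠ 0) :
    IsUnit (1 - PowerSeries.X ^ n * PowerSeries.C t : PowerSeries K) := by
  simp [PowerSeries.isUnit_iff_constantCoeff, hn]

lemma isUnit_one_sub_X_pow {n : ℕ} (hn : n ≠ 0) :
    IsUnit (1 - PowerSeries.X ^ n : PowerSeries K) := by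
  simpa using isUnit_one_sub_X_pow_mul_C (1 : K) hn

lemma specX_P_eq_hookProduct (t : K) (T : BinaryTree Unit) :
    specX t (P K T) = hookProduct PowerSeries.X (PowerSeries.C t) T
      (1 - PowerSeries.X ^ T.left.numNodes * PowerSeries.C t) := by
  refine sub_eq_zero.1 (PowerSeries.ext fun m => ?_)
  have hmod := (specX_P_sModEq t T (m + 1)).trans
    (labelSum_sModEq (PowerSeries.C t) (fun _ => isUnit_one_sub_X_pow) T le_rfl zero_le_one)
  simp only [zero_mul, pow_zero, zero_add] at hmod
  exact PowerSeries.X_pow_dvd_iff.1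
    (Ideal.mem_span_singleton.1 (SModEq.sub_mem.1 hmod)) m m.lt_succ_self

end Specialization

section Nodes

lemma subtreeAt_node_false (e : Unit) (l r : BinaryTree Unit) (s : List Bool) :
    subtreeAt (.node e l r) (false :: s) = subtreeAt l s := rfl

lemma subtreeAt_node_true (e : Unit) (l r : BinaryTree Unit) (s : List Bool) :
    subtreeAt (.node e l r) (true :: s) = subtreeAt r s := rfl

lemma topAncestor_cons (b : Bool) (s : List Bool) :
    topAncestor (b :: s) = if b = true ∧ topAncestor s = [] then [] else b :: topAncestor s := by
  simp only [topAncestor, List.rdropWhile, List.reverse_cons, List.dropWhile_append,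
    List.reverse_eq_nil_iff, List.isEmpty_iff]
  cases b <;> by_cases h : List.dropWhile (fun b => b) s.reverse = [] <;> simp [h]

lemma getLast?_cons_eq_getLast?_of_topAncestor_ne_nil (b : Bool) {s : List Bool}
    (h : topAncestor s ≠ []) : (b :: s).getLast? = s.getLast? := by
  cases s with
  | nil => exact absurd rfl h
  | cons => exact List.getLast?_cons_cons

lemma prod_nodes_node {M : Type*} [CommMonoid M] (e : Unit) (l r : BinaryTree Unit)
    (f : List Bool → M) :
    ∏ s ∈ nodes (.node e l r), f s =
      f [] * (∏ s ∈ nodes l, f (false :: s)) * ∏ s ∈ nodes r, f (true :: s) := by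
  rw [nodes, Finset.prod_union, Finset.prod_union, Finset.prod_singleton,
    Finset.prod_image (by simp), Finset.prod_image (by simp)]
  · simp
  · rw [Finset.disjoint_left]
    intro s hs hs'
    obtain ⟨_, _, rfl⟩ := Finset.mem_image.1 hs'
    simp at hs

end Nodes

section HookFactors

variable {L : Type*} [Field L] (q t y : L)

/-- The `(q,t)`-hook-content `hookContent` of the node `s` of `T`, for arbitrary elements `q` and
`t` of a field. -/
def hookFactor (T : BinaryTree Unit) (s : List Bool) : L :=
  let U := subtreeAt T s
  1 / (1 - q ^ U.numNodes) *
    (if U.right ≠ .nil then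
      q ^ U.right.numNodes - q ^ U.right.left.numNodes * t
    else if s.getLast? = some true then
      1 - q ^ (subtreeAt T (topAncestor s)).left.numNodes * t
    else
      1 - q ^ (U.numNodes - 1) * t)

/-- The `(q,t)`-hook-content of the node `s` of `T`, except that the numerator for the last node of
the right branch starting at the root is `y`. -/
def branchFactor (T : BinaryTree Unit) (s : List Bool) : L :=
  let U := subtreeAt T s
  if U.right = .nil ∧ topAncestor s = [] then 1 / (1 - q ^ U.numNodes) * y else hookFactor q t T s

lemma hookFactor_node_false (e : Unit) (l r : BinaryTree Unit) (s : List Bool) :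
    hookFactor q t (.node e l r) (false :: s) = hookFactor q t l s := by
  have hlast : (false :: s).getLast? = some true ↔ s.getLast? = some true := by
    cases s <;> simp
  simp only [hookFactor, hlast, topAncestor_cons, subtreeAt_node_false, Bool.false_eq_true,
    false_and, if_false]

lemma hookFactor_of_topAncestor_eq_nil {T : BinaryTree Unit} {s : List Bool} (hs : s ≠ [])
    (htop : topAncestor s = []) :
    hookFactor q t T s = branchFactor q t (1 - q ^ T.left.numNodes * t) T s := by
  have hlast : s.getLast? = some true := by
    rw [List.getLast?_eq_some_getLast hs,
      List.rdropWhile_eq_nil_iff.1 htop _ (List.getLast_mem hs)]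
  by_cases hr : (subtreeAt T s).right = .nil
  · simp only [hookFactor, branchFactor, htop, hlast, hr, ne_eq, not_true_eq_false, if_false,
      and_self, if_true, subtreeAt]
  · simp only [branchFactor, hr, false_and, if_false]

lemma branchFactor_of_topAncestor_ne_nil {T : BinaryTree Unit} {s : List Bool}
    (htop : topAncestor s ≠ []) : branchFactor q t y T s = hookFactor q t T s :=
  if_neg fun h => htop h.2

lemma hookFactor_eq_branchFactor (T : BinaryTree Unit) (s : List Bool) :
    hookFactor q t T s = branchFactor q t (1 - q ^ T.left.numNodes * t) T s := by
  by_cases htop : topAncestor s = []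
  · rcases eq_or_ne s [] with rfl | hs
    · cases T with
      | nil => rfl
      | node e l r =>
        cases r with
        | nil => rfl
        | node => rfl
    · exact hookFactor_of_topAncestor_eq_nil q t hs htop
  · exact (branchFactor_of_topAncestor_ne_nil q t _ htop).symm

lemma branchFactor_node_false (e : Unit) (l r : BinaryTree Unit) (s : List Bool) :
    branchFactor q t y (.node e l r) (false :: s) = hookFactor q t l s := by
  rw [branchFactor_of_topAncestor_ne_nil q t y (by simp [topAncestor_cons]), hookFactor_node_false]

lemma branchFactor_node_true (e : Unit) (l r : BinaryTree Unit) (s : List Bool) :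
    branchFactor q t y (.node e l r) (true :: s) = branchFactor q t y r s := by
  have htop : topAncestor (true :: s) = [] ↔ topAncestor s = [] := by simp [topAncestor_cons]
  simp only [branchFactor, subtreeAt_node_true, htop]
  refine ite_congr rfl (fun _ => rfl) fun h => ?_
  by_cases hr : (subtreeAt r s).right = .nil
  · have hs : topAncestor s ≠ [] := fun hs => h ⟨hr, hs⟩
    simp only [hookFactor, subtreeAt_node_true, topAncestor_cons, hs, and_false, if_false,
      getLast?_cons_eq_getLast?_of_topAncestor_ne_nil true hs]
  · simp only [hookFactor, subtreeAt_node_true, ne_eq, hr, not_false_eq_true, if_true]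

lemma prod_branchFactor (T : BinaryTree Unit) (y : L) :
    ∏ s ∈ nodes T, branchFactor q t y T s = hookProduct q t T y := by
  induction T generalizing y with
  | nil => rfl
  | node e l r hl hr =>
    rw [prod_nodes_node]
    simp only [branchFactor_node_false, branchFactor_node_true, hookFactor_eq_branchFactor q t l,
      hl, hr, hookProduct, Ring.inverse_eq_inv']
    rcases eq_or_ne r .nil with rfl | hnil
    · have hroot : branchFactor q t y (.node e l .nil) [] =
          1 / (1 - q ^ (l.numNodes + BinaryTree.numNodes .nil + 1)) * y := rfl
      rw [hroot]
      simp only [hookProduct]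
      ring
    · have hroot : branchFactor q t y (.node e l r) [] =
          1 / (1 - q ^ (l.numNodes + r.numNodes + 1)) *
            (q ^ r.numNodes - q ^ r.left.numNodes * t) :=
        (if_neg fun h => hnil h.1).trans (congrArg _ (if_pos hnil))
      rw [hroot, mul_right_comm, mul_assoc (1 / _), mul_hookProduct_comm q t _ y hnil]
      ring

lemma prod_hookFactor (T : BinaryTree Unit) :
    ∏ s ∈ nodes T, hookFactor q t T s = hookProduct q t T (1 - q ^ T.left.numNodes * t) := by
  simp only [hookFactor_eq_branchFactor q t T, prod_branchFactor]

lemma hookProduct_pow_numNodes_sub_eq_div_mul (T : BinaryTree Unit)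
    (ht : 1 - q ^ T.left.numNodes * t ≠ 0) :
    hookProduct q t T (q ^ T.numNodes - q ^ T.left.numNodes * t) =
      (q ^ T.numNodes - q ^ T.left.numNodes * t) / (1 - q ^ T.left.numNodes * t) *
        hookProduct q t T (1 - q ^ T.left.numNodes * t) := by
  rw [div_mul_eq_mul_div, eq_div_iff ht]
  rcases eq_or_ne T .nil with rfl | hT
  · simp [hookProduct, BinaryTree.numNodes]
  · rw [mul_comm, mul_hookProduct_comm q t _ _ hT]

lemma hookProduct_eq_div_mul_mul {T : BinaryTree Unit} (hT : T ≠ .nil)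
    (ht : 1 - q ^ T.right.left.numNodes * t ≠ 0) :
    hookProduct q t T (1 - q ^ T.left.numNodes * t) =
      ((q ^ T.right.numNodes - q ^ T.right.left.numNodes * t) * (1 - q ^ T.left.numNodes * t)) /
        ((1 - q ^ T.right.left.numNodes * t) * (1 - q ^ T.numNodes)) *
        hookProduct q t T.left (1 - q ^ T.left.left.numNodes * t) *
        hookProduct q t T.right (1 - q ^ T.right.left.numNodes * t) := by
  have hnode : hookProduct q t T (1 - q ^ T.left.numNodes * t) =
      (1 - q ^ T.left.numNodes * t) * Ring.inverse (1 - q ^ T.numNodes) *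
        hookProduct q t T.left (1 - q ^ T.left.left.numNodes * t) *
        hookProduct q t T.right (q ^ T.right.numNodes - q ^ T.right.left.numNodes * t) := by
    cases T with
    | nil => exact absurd rfl hT
    | node e l r => rfl
  rw [hnode, hookProduct_pow_numNodes_sub_eq_div_mul q t _ ht, Ring.inverse_eq_inv', ← div_div]
  ring

end HookFactors

lemma t_ne_one (𝕜 : Type*) [Field 𝕜] : t 𝕜 ≠ 1 := by
  rw [t, ← map_one HahnSeries.C, HahnSeries.C_injective.ne_iff, ← RatFunc.algebraMap_X,
    ← map_one (algebraMap (Polynomial 𝕜) (RatFunc 𝕜)), (RatFunc.algebraMap_injective 𝕜).ne_iff]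
  exact Polynomial.X_ne_C 1

end SuperHook

end

open SuperHook in
theorem mainTheorem7_general {K L : Type*} [CommRing K] [Field L] (φ : PowerSeries K →+* L)
    (t : K) :
    (φ (PowerSeries.C t) ≠ 1 → ∀ T : BinaryTree Unit, T ≠ .nil →
      φ (specX t (P K T)) =
        ((φ PowerSeries.X ^ T.right.numNodes
            - φ PowerSeries.X ^ T.right.left.numNodes * φ (PowerSeries.C t))
          * (1 - φ PowerSeries.X ^ T.left.numNodes * φ (PowerSeries.C t)))
        / ((1 - φ PowerSeries.X ^ T.right.left.numNodes * φ (PowerSeries.C t))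
          * (1 - φ PowerSeries.X ^ T.numNodes))
        * φ (specX t (P K T.left)) * φ (specX t (P K T.right))) ∧
    ∀ T : BinaryTree Unit, φ (specX t (P K T)) =
      ∏ s ∈ nodes T, hookFactor (φ PowerSeries.X) (φ (PowerSeries.C t)) T s := by
  have hspec (T : BinaryTree Unit) : φ (specX t (P K T)) =
      hookProduct (φ PowerSeries.X) (φ (PowerSeries.C t)) T
        (1 - φ PowerSeries.X ^ T.left.numNodes * φ (PowerSeries.C t)) := by
    rw [specX_P_eq_hookProduct, map_hookProduct φ _ fun _ => isUnit_one_sub_X_pow]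
    simp only [map_sub, map_one, map_mul, map_pow]
  refine ⟨fun ht T hT => ?_, fun T => (hspec T).trans (prod_hookFactor _ _ T).symm⟩
  have hne (n : ℕ) : 1 - φ PowerSeries.X ^ n * φ (PowerSeries.C t) ≠ 0 := by
    rcases eq_or_ne n 0 with rfl | hn
    · simpa [sub_eq_zero] using ht.symm
    · simpa using ((isUnit_one_sub_X_pow_mul_C t hn).map φ).ne_zero
  simpa only [hspec] using hookProduct_eq_div_mul_mul _ _ hT (hne _)

theorem mainTheorem7 (𝕜 : Type*) [Field 𝕜] :
    (∀ T : BinaryTree Unit, T ≠ BinaryTree.nil →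
      SuperHook.PX 𝕜 T =
        ((SuperHook.q 𝕜 ^ T.right.numNodes
            - SuperHook.q 𝕜 ^ T.right.left.numNodes * SuperHook.t 𝕜)
          * (1 - SuperHook.q 𝕜 ^ T.left.numNodes * SuperHook.t 𝕜))
        / ((1 - SuperHook.q 𝕜 ^ T.right.left.numNodes * SuperHook.t 𝕜)
          * (1 - SuperHook.q 𝕜 ^ T.numNodes))
        * SuperHook.PX 𝕜 T.left * SuperHook.PX 𝕜 T.right) ∧
    (∀ T : BinaryTree Unit,
      SuperHook.PX 𝕜 T = ∏ s ∈ SuperHook.nodes T, SuperHook.hookContent 𝕜 T s) := by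
  have ht : HahnSeries.ofPowerSeries ℤ (RatFunc 𝕜) (PowerSeries.C RatFunc.X) = SuperHook.t 𝕜 :=
    HahnSeries.ofPowerSeries_C _
  have h := mainTheorem7_general (HahnSeries.ofPowerSeries ℤ (RatFunc 𝕜)) RatFunc.X
  rw [ht] at h
  exact ⟨h.1 (SuperHook.t_ne_one 𝕜), h.2⟩
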